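/- Let $\alpha_i,\beta_i,\gamma_i\in\mathbb C$ ($i=0,1,2$) with $(\gamma_1,\gamma_2)\neq(0,0)$, and consider the map $$f(x_1,x_2)=\left(\alpha_0+\alpha_1x_1+\alpha_2x_2,\ \frac{\beta_0+\beta_1x_1+\beta_2x_2}{\gamma_0+\gamma_1x_1+\gamma_2x_2}\right).$$ Assume that $f$ is birational, i.e. there are a rational map $g$ of $\mathbb C^2$ and an algebraic curve $V\subset\mathbb C^2$ such that $f\circ g$ and $g\circ f$ are defined and equal to the identity on $\mathbb C^2\setminus V$. Let $F:\mathbb P^2\dashrightarrow\mathbb P^2$ be the extension of $f$ under $(x_1,x_2)\mapsto[1:x_1:x_2]$, that is, $$F[x_0:x_1:x_2]=\big[x_0\,\ell_\gamma:\ \ell_\alpha\,\ell_\gamma:\ x_0\,\ell_\beta\big],\qquad \ell_a=a_0x_0+a_1x_1+a_2x_2 .$$ For $n\ge 0$ let $d_n=\deg(F^n)$ be the degree of the homogeneous components of the $n$-th iterate of $F$ after all their common factors have been removed (so $d_0=1$), and let $\delta(F)=\lim_{n\to\infty}d_n^{1/n}$ be the dynamical degree of $F$. Suppose that $\beta_1\gamma_2-\beta_2\gamma_1=0$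 and $\gamma_1\gamma_2\neq0$. Then: (i) if $\alpha_1\neq0$ and $\alpha_2\neq0$, then $\delta(F)=2$ and $d_n=2^n$ for all $n\ge 0$; (ii) if $\alpha_1=0$, then $\delta(F)=\frac{1+\sqrt5}{2}$ and $d_{n+2}=d_{n+1}+d_n$ for all $n\ge 0$; (iii) if $\alpha_2=0$, then $\delta(F)=1$ and $d_n=n+1$ for all $n\ge 0$. In each case the existence of the limit defining $\delta(F)$ is part of the claim. -/

import Mathlib

open MvPolynomial Filter Topology

/-- A rational map `ℂ² ⇢ ℂ²`: each of the two components is a quotient of two polynomials,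
the denominators being nonzero polynomials. -/
structure PlaneRatMap where
  num : Fin 2 → MvPolynomial (Fin 2) ℂ
  den : Fin 2 → MvPolynomial (Fin 2) ℂ
  den_ne_zero : ∀ i, den i ≠ 0

namespace PlaneRatMap

/-- No denominator vanishes at the point `z`. -/
def DefinedAt (φ : PlaneRatMap) (z : Fin 2 → ℂ) : Prop :=
  ∀ i, eval z (φ.den i) ≠ 0

/-- The value at the point `z` (meaningful where the map is defined). -/
noncomputable def toFun (φ : PlaneRatMap) (z : Fin 2 → ℂ) : Fin 2 → ℂ :=
  fun i => eval z (φ.num i) / eval z (φ.den i)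

/-- `φ` is birational: there are a rational map `ψ` and an algebraic curve `V = {h = 0}` such that
`φ ∘ ψ` and `ψ ∘ φ` are defined and equal to the identity on `ℂ² ∖ V`. -/
def IsBirational (φ : PlaneRatMap) : Prop :=
  ∃ (ψ : PlaneRatMap) (h : MvPolynomial (Fin 2) ℂ), h ≠ 0 ∧
    ∀ z : Fin 2 → ℂ, eval z h ≠ 0 →
      (ψ.DefinedAt z ∧ φ.DefinedAt (ψ.toFun z) ∧ φ.toFun (ψ.toFun z) = z) ∧
      (φ.DefinedAt z ∧ ψ.DefinedAt (φ.toFun z) ∧ ψ.toFun (φ.toFun z) = z)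

end PlaneRatMap

/-- The affine polynomial `a₀ + a₁ x₁ + a₂ x₂` on `ℂ²` (the coordinates `x₁, x₂` are `X 0, X 1`). -/
noncomputable def affineForm (a : Fin 3 → ℂ) : MvPolynomial (Fin 2) ℂ :=
  C (a 0) + C (a 1) * X 0 + C (a 2) * X 1

/-- The linear form `a₀ x₀ + a₁ x₁ + a₂ x₂` in homogeneous coordinates. -/
noncomputable def linForm (a : Fin 3 → ℂ) : MvPolynomial (Fin 3) ℂ :=
  C (a 0) * X 0 + C (a 1) * X 1 + C (a 2) * X 2

lemma affineForm_ne_zero {a : Fin 3 → ℂ} (h : (a 1, a 2) ≠ (0, 0)) : affineForm a ≠ 0 := by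
  intro h0
  have h1 := congrArg (eval ![0, 0]) h0
  have h2 := congrArg (eval ![1, 0]) h0
  have h3 := congrArg (eval ![0, 1]) h0
  simp [affineForm] at h1 h2 h3
  simp_all

/-- The map `f(x₁, x₂) = (α₀ + α₁ x₁ + α₂ x₂, (β₀ + β₁ x₁ + β₂ x₂) / (γ₀ + γ₁ x₁ + γ₂ x₂))`,
where `(γ₁, γ₂) ≠ (0, 0)`. -/
noncomputable def familyMap (α β γ : Fin 3 → ℂ) (hγ : (γ 1, γ 2) ≠ (0, 0)) : PlaneRatMap where
  num := ![affineForm α, affineForm β]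
  den := ![1, affineForm γ]
  den_ne_zero := by
    intro i
    fin_cases i
    · simp
    · simpa using affineForm_ne_zero hγ

/-- The extension `F` of the map `f` to the projective plane, under the embedding
`(x₁, x₂) ↦ [1 : x₁ : x₂]`, given by its homogeneous components of degree two. -/
noncomputable def projExtension (α β γ : Fin 3 → ℂ) : Fin 3 → MvPolynomial (Fin 3) ℂ :=
  ![X 0 * linForm γ, linForm α * linForm γ, X 0 * linForm β]

/-- `F` extends `f`: one has `F[1 : x₁ : x₂] = [1 : f₁ : f₂]`, with scaling factor
`γ₀ + γ₁ x₁ + γ₂ x₂`, wherever `f` is defined. -/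
lemma projExtension_eval (α β γ : Fin 3 → ℂ) (hγ : (γ 1, γ 2) ≠ (0, 0)) (z : Fin 2 → ℂ)
    (hz : (familyMap α β γ hγ).DefinedAt z) :
    (fun i => eval ![1, z 0, z 1] (projExtension α β γ i)) =
      eval z (affineForm γ) •
        ![1, (familyMap α β γ hγ).toFun z 0, (familyMap α β γ hγ).toFun z 1] := by
  have h1 : eval z (affineForm γ) ≠ 0 := by simpa [familyMap] using hz 1
  simp only [affineForm, map_add, map_mul, eval_C, eval_X] at h1
  funext i
  fin_cases i
  · simp [projExtension, linForm, affineForm]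
  · simp [projExtension, familyMap, PlaneRatMap.toFun, linForm, affineForm, mul_comm]
  · simp [projExtension, familyMap, PlaneRatMap.toFun, linForm, affineForm, mul_div_cancel₀ _ h1]

/-- The components of the `n`-fold composition `F ∘ ⋯ ∘ F`, before any common factor is removed. -/
noncomputable def iterComponents (F : Fin 3 → MvPolynomial (Fin 3) ℂ) :
    ℕ → Fin 3 → MvPolynomial (Fin 3) ℂ
  | 0 => X
  | n + 1 => fun i => bind₁ (iterComponents F n) (F i)

/-- `Q` is obtained from `P` by removing all common factors of the three components. -/
def IsReductionOf (Q P : Fin 3 → MvPolynomial (Fin 3) ℂ) : Prop :=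
  (∃ G, ∀ i, P i = G * Q i) ∧ ∀ H, (∀ i, H ∣ Q i) → IsUnit H

lemma exists_isReductionOf (P : Fin 3 → MvPolynomial (Fin 3) ℂ) : ∃ Q, IsReductionOf Q P := by
  classical
  let _ : StrongNormalizationMonoid (MvPolynomial (Fin 3) ℂ) :=
    UniqueFactorizationMonoid.strongNormalizationMonoid
  let _ : NormalizedGCDMonoid (MvPolynomial (Fin 3) ℂ) :=
    UniqueFactorizationMonoid.toNormalizedGCDMonoid _
  obtain ⟨Q, h1, h2⟩ := Finset.extract_gcd P (s := Finset.univ) Finset.univ_nonempty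
  refine ⟨Q, ⟨_, fun i => h1 i (Finset.mem_univ i)⟩, fun H hH => ?_⟩
  exact isUnit_of_dvd_one (h2 ▸ Finset.dvd_gcd fun i _ => hH i)

lemma IsReductionOf.dvd {P Q R : Fin 3 → MvPolynomial (Fin 3) ℂ} (hP : P ≠ 0)
    (hQ : IsReductionOf Q P) (hR : IsReductionOf R P) (i : Fin 3) : R i ∣ Q i := by
  classical
  let _ : StrongNormalizationMonoid (MvPolynomial (Fin 3) ℂ) :=
    UniqueFactorizationMonoid.strongNormalizationMonoid
  let _ : NormalizedGCDMonoid (MvPolynomial (Fin 3) ℂ) :=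
    UniqueFactorizationMonoid.toNormalizedGCDMonoid _
  obtain ⟨⟨G, hG⟩, -⟩ := hQ
  obtain ⟨⟨K, hK⟩, hR⟩ := hR
  have hu : IsUnit (Finset.univ.gcd R) :=
    hR _ fun j => Finset.gcd_dvd (Finset.mem_univ j)
  have h1 : G ∣ K * Finset.univ.gcd R := by
    have h2 : G ∣ Finset.univ.gcd fun j => K * R j :=
      Finset.dvd_gcd fun j _ => ⟨Q j, by rw [← hK, hG]⟩
    exact h2.trans (Finset.gcd_mul_left' Finset.univ R K).dvd
  obtain ⟨L, rfl⟩ := (hu.dvd_mul_right).1 h1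
  have hG0 : G ≠ 0 := by
    rintro rfl
    exact hP (funext fun j => by simp [hG])
  refine ⟨L, mul_left_cancel₀ hG0 ?_⟩
  rw [← hG, hK]
  ring

/-- The degree of the rational self-map of the projective plane with homogeneous components
`P 0, P 1, P 2`: the degree of the components once all common factors have been removed. -/
noncomputable def ratDegree (P : Fin 3 → MvPolynomial (Fin 3) ℂ) : ℕ :=
  Finset.univ.sup fun i => ((exists_isReductionOf P).choose i).totalDegree

/-- The degree does not depend on how the common factors have been removed. -/
lemma ratDegree_eq {P Q : Fin 3 → MvPolynomial (Fin 3) ℂ} (hP : P ≠ 0) (hQ : IsReductionOf Q P) :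
    ratDegree P = Finset.univ.sup fun i => (Q i).totalDegree := by
  have hR := (exists_isReductionOf P).choose_spec
  refine Finset.sup_congr rfl fun i _ => ?_
  have h1 := IsReductionOf.dvd hP hQ hR i
  have h2 := IsReductionOf.dvd hP hR hQ i
  by_cases h0 : Q i = 0
  · rw [h0] at h2 ⊢
    rw [zero_dvd_iff.1 h2]
  · have h3 : (exists_isReductionOf P).choose i ≠ 0 := fun h => h0 (zero_dvd_iff.1 (h ▸ h1))
    exact le_antisymm (totalDegree_le_of_dvd_of_isDomain h1 h0)
      (totalDegree_le_of_dvd_of_isDomain h2 h3)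

/-- The sequence `d_n` of the degrees of the iterates of `F` (with `d_0 = 1`). -/
noncomputable def degSeq (F : Fin 3 → MvPolynomial (Fin 3) ℂ) (n : ℕ) : ℕ :=
  ratDegree (iterComponents F n)

/-- `δ` is the dynamical degree of `F`: the limit of `d_n ^ (1 / n)` exists and equals `δ`. -/
def HasDynamicalDegree (F : Fin 3 → MvPolynomial (Fin 3) ℂ) (δ : ℝ) : Prop :=
  Tendsto (fun n : ℕ => (degSeq F n : ℝ) ^ (1 / (n : ℝ))) atTop (𝓝 δ)

/-! The vanishing determinant makes `(β 1, β 2)` a multiple `c` of `(γ 1, γ 2)`, so the map is `(x,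
y) ↦ (ℓ_α, c + b / ℓ_γ)`. Birationality forces `b ≠ 0` and `(α 1, α 2) ≠ (0, 0)`, since otherwise a
coordinate would be constant. A degree can drop only when a curve is contracted and later meets
indeterminacy, which algebraically is a common prime factor of the components.

If `α 1` and `α 2` are nonzero, every curve sent to infinity lands on `[0:1:0]` or `[0:0:1]`, off
the lines `ℓ_γ = 0` and `ℓ_α = 0`. No factor ever appears (`iterComponents_not_dvd`), and the degree
doubles.

If `α 2 = 0`, the first coordinate evolves affinely by itself and the second by Möbius maps over it.
If `α 1 = 0`, the second coordinate satisfies a second-order recurrence `y'' = c + b / ℓ_γ(α₀ + α₂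
y, y')`. In both cases each step produces an explicit common factor, and coprimality of numerators
and denominators (`fiberPair_coprime`, `recPair_coprime`) shows that nothing else cancels. The
degrees are `n + 1` and Fibonacci numbers respectively. -/

/-! ### Composition with the map and removal of common factors. -/

/-- The linear combination `a₀ P₀ + a₁ P₁ + a₂ P₂`. -/
noncomputable def linComb (a : Fin 3 → ℂ) (P : Fin 3 → MvPolynomial (Fin 3) ℂ) :
    MvPolynomial (Fin 3) ℂ :=
  C (a 0) * P 0 + C (a 1) * P 1 + C (a 2) * P 2

lemma bind₁_linForm (a : Fin 3 → ℂ) (P : Fin 3 → MvPolynomial (Fin 3) ℂ) :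
    bind₁ P (linForm a) = linComb a P := by
  simp [linForm, linComb, algebraMap_eq]

lemma linComb_smul (a : Fin 3 → ℂ) (G : MvPolynomial (Fin 3) ℂ)
    (P : Fin 3 → MvPolynomial (Fin 3) ℂ) : linComb a (fun i => G * P i) = G * linComb a P := by
  simp only [linComb]
  ring

lemma linComb_isHomogeneous {a : Fin 3 → ℂ} {P : Fin 3 → MvPolynomial (Fin 3) ℂ} {d : ℕ}
    (hP : ∀ i, (P i).IsHomogeneous d) : (linComb a P).IsHomogeneous d :=
  (((hP 0).C_mul _).add ((hP 1).C_mul _)).add ((hP 2).C_mul _)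

/-- Post-composition of a triple of polynomials with the map `projExtension α β γ`. -/
noncomputable def projStep (α β γ : Fin 3 → ℂ) (P : Fin 3 → MvPolynomial (Fin 3) ℂ) :
    Fin 3 → MvPolynomial (Fin 3) ℂ :=
  ![P 0 * linComb γ P, linComb α P * linComb γ P, P 0 * linComb β P]

lemma iterComponents_succ (α β γ : Fin 3 → ℂ) (n : ℕ) :
    iterComponents (projExtension α β γ) (n + 1) =
      projStep α β γ (iterComponents (projExtension α β γ) n) := by
  funext i
  fin_cases i <;> simp [iterComponents, projExtension, projStep, bind₁_linForm]

lemma projStep_mul (α β γ : Fin 3 → ℂ) (G : MvPolynomial (Fin 3) ℂ)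
    (P : Fin 3 → MvPolynomial (Fin 3) ℂ) (i : Fin 3) :
    projStep α β γ (fun i => G * P i) i = G ^ 2 * projStep α β γ P i := by
  fin_cases i <;> simp [projStep, linComb_smul] <;> ring

lemma projStep_isHomogeneous {α β γ : Fin 3 → ℂ} {P : Fin 3 → MvPolynomial (Fin 3) ℂ} {d : ℕ}
    (hP : ∀ i, (P i).IsHomogeneous d) (i : Fin 3) :
    (projStep α β γ P i).IsHomogeneous (2 * d) := by
  rw [two_mul]
  fin_cases i
  · exact (hP 0).mul (linComb_isHomogeneous hP)
  · exact (linComb_isHomogeneous hP).mul (linComb_isHomogeneous hP)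
  · exact (hP 0).mul (linComb_isHomogeneous hP)

/-- The iterates of `F` up to common factors, when each step removes a given nonzero factor. -/
lemma exists_iterComponents_eq_mul {α β γ : Fin 3 → ℂ} {m : ℕ}
    {Q : ℕ → Fin 3 → MvPolynomial (Fin 3) ℂ} {g : ℕ → MvPolynomial (Fin 3) ℂ}
    (hg : ∀ n, g n ≠ 0) (h0 : iterComponents (projExtension α β γ) m = Q 0)
    (hstep : ∀ n i, projStep α β γ (Q n) i = g n * Q (n + 1) i) (n : ℕ) :
    ∃ G ≠ 0, ∀ i, iterComponents (projExtension α β γ) (m + n) i = G * Q n i := by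
  induction n with
  | zero => exact ⟨1, one_ne_zero, fun i => by simp [h0]⟩
  | succ n ih =>
    obtain ⟨G, hG, h⟩ := ih
    refine ⟨G ^ 2 * g n, mul_ne_zero (pow_ne_zero _ hG) (hg n), fun i => ?_⟩
    rw [← add_assoc, iterComponents_succ, funext h, projStep_mul, hstep, mul_assoc]

/-- By unique factorization, primes suffice to test that a triple is reduced; homogeneity and one
nonzero component then give the degree. -/
lemma degSeq_eq_of_eq_mul {F : Fin 3 → MvPolynomial (Fin 3) ℂ} {n d : ℕ}
    {Q : Fin 3 → MvPolynomial (Fin 3) ℂ}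
    (hQ : ∃ G ≠ 0, ∀ i, iterComponents F n i = G * Q i)
    (hd : ∀ i, (Q i).IsHomogeneous d) (h0 : Q 0 ≠ 0)
    (hprime : ∀ H, Prime H → ¬ ∀ i, H ∣ Q i) : degSeq F n = d := by
  obtain ⟨G, hG, hG'⟩ := hQ
  have hne : iterComponents F n ≠ 0 := fun h => by
    have := hG' 0
    rw [h] at this
    exact mul_ne_zero hG h0 this.symm
  have hred : IsReductionOf Q (iterComponents F n) := by
    refine ⟨⟨G, hG'⟩, fun H hH => ?_⟩
    by_contra hu
    have hH0 : H ≠ 0 := by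
      rintro rfl
      exact h0 (zero_dvd_iff.1 (hH 0))
    obtain ⟨p, hp, hpH⟩ := WfDvdMonoid.exists_irreducible_factor hu hH0
    exact hprime p hp.prime fun i => hpH.trans (hH i)
  rw [degSeq, ratDegree_eq hne hred]
  refine le_antisymm (Finset.sup_le fun i _ => (hd i).totalDegree_le) ?_
  rw [← (hd 0).totalDegree h0]
  exact Finset.le_sup (f := fun i => (Q i).totalDegree) (Finset.mem_univ 0)

lemma dvd_of_dvd_C_mul {H p : MvPolynomial (Fin 3) ℂ} {a : ℂ} (ha : a ≠ 0)
    (h : H ∣ C a * p) : H ∣ p := by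
  have : p = C a⁻¹ * (C a * p) := by
    rw [← mul_assoc, ← C_mul, inv_mul_cancel₀ ha, C_1, one_mul]
  rw [this]
  exact h.mul_left _

lemma X_zero_not_dvd_linComb_X {a : Fin 3 → ℂ} (h : a 1 ≠ 0) :
    ¬ (X 0 : MvPolynomial (Fin 3) ℂ) ∣ linComb a X := by
  rintro ⟨q, hq⟩
  have := congrArg (eval ![0, 1, 0]) hq
  simp [linComb] at this
  exact h this

lemma X_zero_not_dvd_X {i : Fin 3} (hi : i ≠ 0) :
    ¬ (X 0 : MvPolynomial (Fin 3) ℂ) ∣ X i := by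
  rintro ⟨q, hq⟩
  have := congrArg (eval (Pi.single i (1 : ℂ))) hq
  simp [hi.symm] at this

lemma dvd_X_zero_iff {H : MvPolynomial (Fin 3) ℂ} (hH : Prime H)
    (h : H ∣ X 0) (p : MvPolynomial (Fin 3) ℂ) : H ∣ p ↔ X 0 ∣ p :=
  (hH.associated_of_dvd (X_prime (i := 0)) h).dvd_iff_dvd_left

/-- No component of a birational map is constant. -/
lemma PlaneRatMap.IsBirational.not_const {φ : PlaneRatMap} (h : φ.IsBirational) (k : Fin 2)
    (a : ℂ) : ¬ ∀ z, φ.DefinedAt z → φ.toFun z k = a := by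
  intro hc
  obtain ⟨ψ, g, hg, H⟩ := h
  -- On the curve the first factor vanishes; off it `z = φ (ψ z)`, so the coordinate `z k` equals
  -- `a`.
  have h0 : g * (X k - C a) = 0 := by
    apply MvPolynomial.funext
    intro z
    by_cases hz : eval z g = 0
    · simp [hz]
    · obtain ⟨⟨-, h1, h2⟩, -⟩ := H z hz
      have := hc _ h1
      rw [h2] at this
      simp [this]
  rcases mul_eq_zero.1 h0 with h | h
  · exact hg h
  · have := congrArg (eval fun _ => a + 1) h
    simp at this

/-! ### Both `α 1` and `α 2` nonzero: no cancellation. -/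

section Generic

variable {α β γ : Fin 3 → ℂ} {b c : ℂ}

lemma linComb_eq_of_proportional (hβ : β = ![c * γ 0 + b, c * γ 1, c * γ 2])
    (P : Fin 3 → MvPolynomial (Fin 3) ℂ) : linComb β P = C c * linComb γ P + C b * P 0 := by
  simp [linComb, hβ]
  ring

/-- A prime factor of the first component of an iterate, i.e. a curve mapped to the line at
infinity, is mapped neither to the line `ℓ_γ = 0` nor to the line `ℓ_α = 0`. -/
lemma iterComponents_not_dvd (hβ : β = ![c * γ 0 + b, c * γ 1, c * γ 2]) (hb : b ≠ 0)
    (hγ1 : γ 1 ≠ 0) (hγ2 : γ 2 ≠ 0) (hα1 : α 1 ≠ 0) (hα2 : α 2 ≠ 0) (n : ℕ)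
    {H : MvPolynomial (Fin 3) ℂ} (hH : Prime H)
    (hd : H ∣ iterComponents (projExtension α β γ) n 0) :
    ¬ H ∣ linComb γ (iterComponents (projExtension α β γ) n) ∧
      ¬ H ∣ linComb α (iterComponents (projExtension α β γ) n) := by
  induction n with
  | zero =>
    have hd' : H ∣ X 0 := hd
    rw [dvd_X_zero_iff hH hd', dvd_X_zero_iff hH hd']
    exact ⟨X_zero_not_dvd_linComb_X hγ1, X_zero_not_dvd_linComb_X hα1⟩
  | succ n ih =>
    rw [iterComponents_succ] at hd ⊢
    set P := iterComponents (projExtension α β γ) n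
    have e0 : projStep α β γ P 0 = P 0 * linComb γ P := rfl
    have e1 : projStep α β γ P 1 = linComb α P * linComb γ P := rfl
    have e2 : projStep α β γ P 2 = P 0 * (C c * linComb γ P + C b * P 0) := by
      rw [← linComb_eq_of_proportional hβ]; rfl
    rw [e0] at hd
    have key : ∀ a : Fin 3 → ℂ, a 1 ≠ 0 → a 2 ≠ 0 → ¬ H ∣ linComb a (projStep α β γ P) := by
      intro a ha1 ha2 h
      rw [linComb, e0, e1, e2] at h
      -- Modulo `H` the new triple is `(0, ℓ_α ℓ_γ, 0)` if `H` divides `P 0`, and `(0, 0, b P₀²)`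
      -- otherwise. The coefficients `a 1` and `a 2` detect these two points.
      by_cases hP : H ∣ P 0
      · obtain ⟨h1, h2⟩ := ih hP
        have h3 : H ∣ C (a 1) * (linComb α P * linComb γ P) := by
          obtain ⟨q, hq⟩ := hP
          obtain ⟨s, hs⟩ := h
          refine ⟨s - C (a 0) * (q * linComb γ P) -
            C (a 2) * (q * (C c * linComb γ P + C b * P 0)), ?_⟩
          linear_combination hs - C (a 0) * linComb γ P * hq -
            C (a 2) * (C c * linComb γ P + C b * P 0) * hq
        rcases hH.dvd_or_dvd (dvd_of_dvd_C_mul ha1 h3) with h4 | h4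
        · exact h2 h4
        · exact h1 h4
      · obtain ⟨q, hq⟩ := (hH.dvd_or_dvd hd).resolve_left hP
        obtain ⟨s, hs⟩ := h
        have h3 : H ∣ C (a 2) * (C b * (P 0 * P 0)) := by
          refine ⟨s - C (a 0) * P 0 * q - C (a 1) * linComb α P * q - C (a 2) * P 0 * C c * q, ?_⟩
          linear_combination hs -
            (C (a 0) * P 0 + C (a 1) * linComb α P + C (a 2) * P 0 * C c) * hq
        have h4 := dvd_of_dvd_C_mul hb (dvd_of_dvd_C_mul ha2 h3)
        exact hP ((hH.dvd_or_dvd h4).elim id id)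
    exact ⟨key γ hγ1 hγ2, key α hα1 hα2⟩

lemma iterComponents_isHomogeneous (n : ℕ) (i : Fin 3) :
    (iterComponents (projExtension α β γ) n i).IsHomogeneous (2 ^ n) := by
  induction n generalizing i with
  | zero => exact isHomogeneous_X ℂ i
  | succ n ih =>
    rw [iterComponents_succ, pow_succ']
    exact projStep_isHomogeneous ih i

lemma degSeq_eq_two_pow (hβ : β = ![c * γ 0 + b, c * γ 1, c * γ 2]) (hb : b ≠ 0)
    (hγ1 : γ 1 ≠ 0) (hγ2 : γ 2 ≠ 0) (hα1 : α 1 ≠ 0) (hα2 : α 2 ≠ 0) (n : ℕ) :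
    degSeq (projExtension α β γ) n = 2 ^ n := by
  -- The line at infinity is invariant; applied to `X 0`, the non-divisibility lemma shows that
  -- `ℓ_γ` of an iterate is never zero.
  have hX : ∀ n, X 0 ∣ iterComponents (projExtension α β γ) n 0 := by
    intro n
    induction n with
    | zero => exact dvd_rfl
    | succ n ih =>
      rw [iterComponents_succ]
      exact ih.mul_right _
  have h0 : ∀ n, iterComponents (projExtension α β γ) n 0 ≠ 0 := by
    intro n
    induction n with
    | zero => exact X_ne_zero 0
    | succ n ih =>
      rw [iterComponents_succ]
      refine mul_ne_zero ih fun h => ?_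
      exact (iterComponents_not_dvd hβ hb hγ1 hγ2 hα1 hα2 n (X_prime (i := 0)) (hX n)).1
        (h ▸ dvd_zero _)
  refine degSeq_eq_of_eq_mul ⟨1, one_ne_zero, fun i => (one_mul _).symm⟩
    (iterComponents_isHomogeneous n) (h0 n) fun H hH h => ?_
  refine (iterComponents_not_dvd hβ hb hγ1 hγ2 hα1 hα2 n hH (h 0)).1 ?_
  exact dvd_add (dvd_add ((h 0).mul_left _) ((h 1).mul_left _)) ((h 2).mul_left _)

end Generic

/-! ### The case `α 2 = 0`: linear growth. -/

section Fibered

variable {α β γ : Fin 3 → ℂ} {b c : ℂ}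

/-- The first coordinate of the iterates when it evolves by itself, homogenized. -/
noncomputable def baseForm (α : Fin 3 → ℂ) : ℕ → MvPolynomial (Fin 3) ℂ
  | 0 => X 1
  | n + 1 => C (α 0) * X 0 + C (α 1) * baseForm α n

/-- Denominator and numerator of the second coordinate of the iterates, homogenized, when the
first coordinate evolves by itself. -/
noncomputable def fiberPair (α γ : Fin 3 → ℂ) (b c : ℂ) :
    ℕ → MvPolynomial (Fin 3) ℂ × MvPolynomial (Fin 3) ℂ
  | 0 => (1, X 2)
  | n + 1 =>
    let q := (fiberPair α γ b c n).1
    let Γ := linComb γ ![X 0 * q, baseForm α n * q, (fiberPair α γ b c n).2]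
    (Γ, X 0 * (C c * Γ + C b * (X 0 * q)))

/-- The reduced components of the iterates when the first coordinate evolves by itself. -/
noncomputable def fiberedIterate (α γ : Fin 3 → ℂ) (b c : ℂ) (n : ℕ) :
    Fin 3 → MvPolynomial (Fin 3) ℂ :=
  ![X 0 * (fiberPair α γ b c n).1, baseForm α n * (fiberPair α γ b c n).1,
    (fiberPair α γ b c n).2]

lemma fiberPair_succ_fst (n : ℕ) :
    (fiberPair α γ b c (n + 1)).1 = linComb γ (fiberedIterate α γ b c n) := rfl

lemma fiberPair_succ_snd (n : ℕ) : (fiberPair α γ b c (n + 1)).2 =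
    X 0 * (C c * (fiberPair α γ b c (n + 1)).1 + C b * (X 0 * (fiberPair α γ b c n).1)) := rfl

/-- With `α 2 = 0` the form `ℓ_α` no longer sees the third component, so the old denominator divides
all three new components. -/
lemma projStep_fiberedIterate (hβ : β = ![c * γ 0 + b, c * γ 1, c * γ 2]) (hα2 : α 2 = 0)
    (n : ℕ) (i : Fin 3) : projStep α β γ (fiberedIterate α γ b c n) i =
      (fiberPair α γ b c n).1 * fiberedIterate α γ b c (n + 1) i := by
  rw [projStep, linComb_eq_of_proportional hβ, ← fiberPair_succ_fst]
  fin_cases i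
  · simp [fiberedIterate]
    ring
  · simp [fiberedIterate, linComb, hα2, baseForm]
    ring
  · simp [fiberedIterate, fiberPair_succ_snd n]
    ring

lemma baseForm_isHomogeneous (n : ℕ) : (baseForm α n).IsHomogeneous 1 := by
  induction n with
  | zero => exact isHomogeneous_X ℂ 1
  | succ n ih => exact ((isHomogeneous_X ℂ 0).C_mul _).add (ih.C_mul _)

lemma X_zero_not_dvd_baseForm (hα1 : α 1 ≠ 0) (n : ℕ) : ¬ X 0 ∣ baseForm α n := by
  induction n with
  | zero => exact X_zero_not_dvd_X (by decide)
  | succ n ih =>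
    intro h
    exact ih (dvd_of_dvd_C_mul hα1 ((dvd_add_right (Dvd.intro_left _ rfl)).1 h))

lemma fiberPair_isHomogeneous (n : ℕ) : (fiberPair α γ b c n).1.IsHomogeneous n ∧
    (fiberPair α γ b c n).2.IsHomogeneous (n + 1) ∧
    ∀ i, (fiberedIterate α γ b c n i).IsHomogeneous (n + 1) := by
  have aux : ∀ n, (fiberPair α γ b c n).1.IsHomogeneous n →
      (fiberPair α γ b c n).2.IsHomogeneous (n + 1) →
      ∀ i, (fiberedIterate α γ b c n i).IsHomogeneous (n + 1) := by
    intro n h1 h2 i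
    fin_cases i
    · rw [add_comm]; exact (isHomogeneous_X ℂ 0).mul h1
    · rw [add_comm]; exact (baseForm_isHomogeneous n).mul h1
    · exact h2
  induction n with
  | zero => exact ⟨isHomogeneous_one _ _, isHomogeneous_X ℂ 2,
      aux 0 (isHomogeneous_one _ _) (isHomogeneous_X ℂ 2)⟩
  | succ n ih =>
    have h1 : (fiberPair α γ b c (n + 1)).1.IsHomogeneous (n + 1) := linComb_isHomogeneous ih.2.2
    have h2 : (fiberPair α γ b c (n + 1)).2.IsHomogeneous (n + 1 + 1) := by
      rw [fiberPair_succ_snd, add_comm (n + 1)]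
      exact (isHomogeneous_X ℂ 0).mul ((h1.C_mul _).add (.C_mul (ih.2.2 0) _))
    exact ⟨h1, h2, aux _ h1 h2⟩

lemma X_zero_not_dvd_fiberPair (hγ1 : γ 1 ≠ 0) (hα1 : α 1 ≠ 0) (n : ℕ) :
    ¬ X 0 ∣ (fiberPair α γ b c n).1 := by
  induction n with
  | zero => exact fun h => (X_prime (R := ℂ) (i := (0 : Fin 3))).not_isUnit (isUnit_of_dvd_one h)
  | succ n ih =>
    rw [fiberPair_succ_fst]
    -- The initial numerator `X 2` is not divisible by `X 0`, but all later ones are. From then on,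
    -- modulo `X 0`, only the `γ 1` term survives in the new denominator.
    cases n with
    | zero =>
      have : fiberedIterate α γ b c 0 = X := by
        funext i
        fin_cases i <;> simp [fiberedIterate, fiberPair, baseForm]
      rw [this]
      exact X_zero_not_dvd_linComb_X hγ1
    | succ n =>
      intro h
      have h1 : X 0 ∣ fiberedIterate α γ b c (n + 1) 0 := Dvd.intro _ rfl
      have h2 : X 0 ∣ fiberedIterate α γ b c (n + 1) 2 := Dvd.intro _ rfl
      rw [linComb, dvd_add_left (h2.mul_left _), dvd_add_right (h1.mul_left _)] at h
      rcases (X_prime (i := 0)).dvd_or_dvd (dvd_of_dvd_C_mul hγ1 h) with h3 | h3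
      · exact X_zero_not_dvd_baseForm hα1 _ h3
      · exact ih h3

/-- Descent: a common prime factor is not `X 0`, so `b ≠ 0` makes it divide the previous
denominator, and `γ 2 ≠ 0` the previous numerator. -/
lemma fiberPair_coprime (hb : b ≠ 0) (hγ1 : γ 1 ≠ 0) (hγ2 : γ 2 ≠ 0) (hα1 : α 1 ≠ 0) (n : ℕ)
    {H : MvPolynomial (Fin 3) ℂ} (hH : Prime H) (h1 : H ∣ (fiberPair α γ b c n).1) :
    ¬ H ∣ (fiberPair α γ b c n).2 := by
  induction n with
  | zero => exact fun _ => hH.not_isUnit (isUnit_of_dvd_one h1)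
  | succ n ih =>
    intro h2
    have hX : ¬ H ∣ X 0 := fun h =>
      X_zero_not_dvd_fiberPair hγ1 hα1 (n + 1) ((dvd_X_zero_iff hH h _).1 h1)
    have h3 := (hH.dvd_or_dvd h2).resolve_left hX
    rw [dvd_add_right (Dvd.dvd.mul_left (by exact h1) _)] at h3
    have h4 := (hH.dvd_or_dvd (dvd_of_dvd_C_mul hb h3)).resolve_left hX
    refine ih h4 (dvd_of_dvd_C_mul hγ2 ?_)
    rw [fiberPair_succ_fst, linComb] at h1
    refine (dvd_add_right (dvd_add (Dvd.dvd.mul_left ?_ _) (Dvd.dvd.mul_left ?_ _))).1 h1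
    · exact h4.mul_left _
    · exact h4.mul_left _

lemma degSeq_eq_succ (hβ : β = ![c * γ 0 + b, c * γ 1, c * γ 2]) (hb : b ≠ 0)
    (hγ1 : γ 1 ≠ 0) (hγ2 : γ 2 ≠ 0) (hα1 : α 1 ≠ 0) (hα2 : α 2 = 0) (n : ℕ) :
    degSeq (projExtension α β γ) n = n + 1 := by
  have hq : ∀ n, (fiberPair α γ b c n).1 ≠ 0 := fun n h =>
    X_zero_not_dvd_fiberPair hγ1 hα1 n (h ▸ dvd_zero _)
  have h0 : iterComponents (projExtension α β γ) 0 = fiberedIterate α γ b c 0 := by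
    funext i
    fin_cases i <;> simp [fiberedIterate, fiberPair, baseForm, iterComponents]
  have hG := exists_iterComponents_eq_mul hq h0 (projStep_fiberedIterate hβ hα2) n
  rw [zero_add] at hG
  refine degSeq_eq_of_eq_mul hG (fiberPair_isHomogeneous n).2.2
    (mul_ne_zero (X_ne_zero 0) (hq n)) fun H hH h => ?_
  have hd : ¬ H ∣ (fiberPair α γ b c n).1 := fun h1 =>
    fiberPair_coprime hb hγ1 hγ2 hα1 n hH h1 (h 2)
  have hX := (hH.dvd_or_dvd (h 0)).resolve_right hd
  exact X_zero_not_dvd_baseForm hα1 n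
    ((dvd_X_zero_iff hH hX _).1 ((hH.dvd_or_dvd (h 1)).resolve_right hd))

end Fibered

/-! ### The case `α 1 = 0`: Fibonacci growth. -/

section Recurrence

variable {α β γ : Fin 3 → ℂ} {b c : ℂ}

/-- The components of the iterate whose successive second coordinates are `u.2 / u.1` and
`v.2 / v.1`, when the first coordinate of the map depends on the second variable only. -/
noncomputable def pairTriple (α : Fin 3 → ℂ) (u v : MvPolynomial (Fin 3) ℂ × MvPolynomial (Fin 3) ℂ) :
    Fin 3 → MvPolynomial (Fin 3) ℂ :=
  ![u.1 * v.1, (C (α 0) * u.1 + C (α 2) * u.2) * v.1, u.1 * v.2]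

/-- Denominator and numerator of the second coordinate of the iterates, homogenized, when the
first coordinate of the map depends on the second variable only. -/
noncomputable def recPair (α γ : Fin 3 → ℂ) (b c : ℂ) :
    ℕ → MvPolynomial (Fin 3) ℂ × MvPolynomial (Fin 3) ℂ
  | 0 => (X 0, X 2)
  | 1 => (linComb γ X, C c * linComb γ X + C b * X 0)
  | n + 2 =>
    let Γ := linComb γ (pairTriple α (recPair α γ b c n) (recPair α γ b c (n + 1)))
    (Γ, C c * Γ + C b * ((recPair α γ b c n).1 * (recPair α γ b c (n + 1)).1))

/-- The reduced components of the `(n + 1)`-st iterate when the first coordinate of the map depends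
on the second variable only. -/
noncomputable def recIterate (α γ : Fin 3 → ℂ) (b c : ℂ) (n : ℕ) :
    Fin 3 → MvPolynomial (Fin 3) ℂ :=
  pairTriple α (recPair α γ b c n) (recPair α γ b c (n + 1))

lemma recPair_add_two_fst (n : ℕ) :
    (recPair α γ b c (n + 2)).1 = linComb γ (recIterate α γ b c n) := by
  rw [recPair, recIterate]

lemma recPair_add_two_snd (n : ℕ) : (recPair α γ b c (n + 2)).2 =
    C c * (recPair α γ b c (n + 2)).1 +
      C b * ((recPair α γ b c n).1 * (recPair α γ b c (n + 1)).1) := by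
  rw [recPair]

lemma recPair_add_two_fst_eq (n : ℕ) : (recPair α γ b c (n + 2)).1 =
    (C (γ 0) + C (γ 1) * C (α 0)) * (recPair α γ b c n).1 * (recPair α γ b c (n + 1)).1 +
      C (γ 1) * (C (α 2) * ((recPair α γ b c n).2 * (recPair α γ b c (n + 1)).1)) +
      C (γ 2) * ((recPair α γ b c (n + 1)).2 * (recPair α γ b c n).1) := by
  rw [recPair_add_two_fst, recIterate, linComb, pairTriple]
  simp
  ring

lemma projStep_recIterate (hβ : β = ![c * γ 0 + b, c * γ 1, c * γ 2]) (hα1 : α 1 = 0)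
    (n : ℕ) (i : Fin 3) : projStep α β γ (recIterate α γ b c n) i =
      (recPair α γ b c n).1 * recIterate α γ b c (n + 1) i := by
  rw [projStep, linComb_eq_of_proportional hβ, ← recPair_add_two_fst]
  fin_cases i
  · simp [recIterate, pairTriple]
    ring
  · simp [recIterate, pairTriple, linComb, hα1]
    ring
  · simp [recIterate, pairTriple, recPair_add_two_snd n]
    ring

lemma iterComponents_one_eq_recIterate (hβ : β = ![c * γ 0 + b, c * γ 1, c * γ 2])
    (hα1 : α 1 = 0) : iterComponents (projExtension α β γ) 1 = recIterate α γ b c 0 := by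
  rw [iterComponents_succ, projStep, linComb_eq_of_proportional hβ]
  funext i
  fin_cases i
  · simp [iterComponents, recIterate, pairTriple, recPair]
  · simp [iterComponents, recIterate, pairTriple, recPair, linComb, hα1]
  · simp [iterComponents, recIterate, pairTriple, recPair]

lemma pairTriple_isHomogeneous {u v : MvPolynomial (Fin 3) ℂ × MvPolynomial (Fin 3) ℂ} {d e : ℕ}
    (hu1 : u.1.IsHomogeneous d) (hu2 : u.2.IsHomogeneous d) (hv1 : v.1.IsHomogeneous e)
    (hv2 : v.2.IsHomogeneous e) (i : Fin 3) : (pairTriple α u v i).IsHomogeneous (d + e) := by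
  fin_cases i
  · exact hu1.mul hv1
  · exact ((hu1.C_mul _).add (hu2.C_mul _)).mul hv1
  · exact hu1.mul hv2

lemma recPair_isHomogeneous (n : ℕ) :
    (recPair α γ b c n).1.IsHomogeneous (Nat.fib (n + 1)) ∧
      (recPair α γ b c n).2.IsHomogeneous (Nat.fib (n + 1)) := by
  induction n using Nat.twoStepInduction with
  | zero => exact ⟨isHomogeneous_X ℂ 0, isHomogeneous_X ℂ 2⟩
  | one =>
    have h : (linComb γ X).IsHomogeneous 1 := linComb_isHomogeneous fun i => isHomogeneous_X ℂ i
    exact ⟨by simpa [recPair] using h,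
      by simpa [recPair] using (h.C_mul c).add ((isHomogeneous_X ℂ 0).C_mul b)⟩
  | more n h1 h2 =>
    have h3 : (recPair α γ b c (n + 2)).1.IsHomogeneous (Nat.fib (n + 2 + 1)) := by
      rw [recPair_add_two_fst, Nat.fib_add_two]
      exact linComb_isHomogeneous (pairTriple_isHomogeneous h1.1 h1.2 h2.1 h2.2)
    refine ⟨h3, ?_⟩
    rw [recPair_add_two_snd]
    refine (h3.C_mul c).add (IsHomogeneous.C_mul ?_ b)
    rw [Nat.fib_add_two]
    exact h1.1.mul h2.1

/-- The three statements need a joint induction: each new denominator is bilinear in the two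
preceding pairs, so coprimality within pairs and between consecutive denominators feed each other.
-/
lemma recPair_coprime (hb : b ≠ 0) (hγ1 : γ 1 ≠ 0) (hγ2 : γ 2 ≠ 0) (hα2 : α 2 ≠ 0)
    {H : MvPolynomial (Fin 3) ℂ} (hH : Prime H) (n : ℕ) :
    ¬ (H ∣ (recPair α γ b c n).1 ∧ H ∣ (recPair α γ b c n).2) ∧
    ¬ (H ∣ (recPair α γ b c (n + 1)).1 ∧ H ∣ (recPair α γ b c (n + 1)).2) ∧
    ¬ (H ∣ (recPair α γ b c n).1 ∧ H ∣ (recPair α γ b c (n + 1)).1) := by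
  induction n with
  | zero =>
    have key : H ∣ X 0 → ¬ H ∣ linComb γ X := fun h h' =>
      X_zero_not_dvd_linComb_X hγ1 ((dvd_X_zero_iff hH h _).1 h')
    simp only [recPair]
    refine ⟨fun h => X_zero_not_dvd_X (i := 2) (by decide) ((dvd_X_zero_iff hH h.1 _).1 h.2),
      fun h => ?_, fun h => key h.1 h.2⟩
    rw [dvd_add_right (h.1.mul_left _)] at h
    exact key (dvd_of_dvd_C_mul hb h.2) h.1
  | succ n ih =>
    obtain ⟨h1, h2, h3⟩ := ih
    have key : ¬ (H ∣ (recPair α γ b c (n + 1)).1 ∧ H ∣ (recPair α γ b c (n + 2)).1) := by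
      rintro ⟨h4, h5⟩
      rw [recPair_add_two_fst_eq, dvd_add_right (dvd_add (h4.mul_left _)
        (((h4.mul_left _).mul_left _).mul_left _))] at h5
      rcases hH.dvd_or_dvd (dvd_of_dvd_C_mul hγ2 h5) with h6 | h6
      · exact h2 ⟨h4, h6⟩
      · exact h3 ⟨h6, h4⟩
    refine ⟨h2, ?_, key⟩
    rintro ⟨h4, h5⟩
    rw [recPair_add_two_snd, dvd_add_right (h4.mul_left _)] at h5
    rcases hH.dvd_or_dvd (dvd_of_dvd_C_mul hb h5) with h6 | h6
    · rw [recPair_add_two_fst_eq, dvd_add_left ((h6.mul_left _).mul_left _),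
        dvd_add_right ((h6.mul_left _).mul_right _)] at h4
      rcases hH.dvd_or_dvd (dvd_of_dvd_C_mul hα2 (dvd_of_dvd_C_mul hγ1 h4)) with h7 | h7
      · exact h1 ⟨h6, h7⟩
      · exact h3 ⟨h6, h7⟩
    · exact key ⟨h6, h4⟩

lemma recPair_fst_ne_zero (hb : b ≠ 0) (hγ1 : γ 1 ≠ 0) (hγ2 : γ 2 ≠ 0) (hα2 : α 2 ≠ 0) (n : ℕ) :
    (recPair α γ b c n).1 ≠ 0 := by
  induction n with
  | zero => exact X_ne_zero 0
  | succ n ih =>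
    intro h
    -- The degree `Nat.fib (n + 1)` is positive, so there is a prime factor; it would also divide a
    -- vanishing next denominator, against coprimality.
    have hu : ¬ IsUnit (recPair α γ b c n).1 := fun hu => by
      have h1 := (recPair_isHomogeneous (α := α) (γ := γ) (b := b) (c := c) n).1.totalDegree ih
      rw [(MvPolynomial.isUnit_iff_totalDegree_of_isReduced.1 hu).2] at h1
      exact (Nat.fib_pos.2 n.succ_pos).ne h1
    obtain ⟨p, hp, hd⟩ := WfDvdMonoid.exists_irreducible_factor hu ih
    exact (recPair_coprime hb hγ1 hγ2 hα2 hp.prime n).2.2 ⟨hd, h ▸ dvd_zero _⟩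

lemma degSeq_eq_fib (hβ : β = ![c * γ 0 + b, c * γ 1, c * γ 2]) (hb : b ≠ 0)
    (hγ1 : γ 1 ≠ 0) (hγ2 : γ 2 ≠ 0) (hα1 : α 1 = 0) (hα2 : α 2 ≠ 0) (n : ℕ) :
    degSeq (projExtension α β γ) n = Nat.fib (n + 2) := by
  have hr := recPair_fst_ne_zero (c := c) hb hγ1 hγ2 hα2
  -- The form `recIterate` describes iterates only from the first on, since the initial `X 1` is not
  -- determined by the second coordinate.
  cases n with
  | zero =>
    refine degSeq_eq_of_eq_mul (Q := X) ⟨1, one_ne_zero, fun i => (one_mul _).symm⟩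
      (fun i => isHomogeneous_X ℂ i) (X_ne_zero 0) fun H hH h => ?_
    exact X_zero_not_dvd_X (i := 1) (by decide) ((dvd_X_zero_iff hH (h 0) _).1 (h 1))
  | succ n =>
    have hG := exists_iterComponents_eq_mul hr (iterComponents_one_eq_recIterate hβ hα1)
      (projStep_recIterate hβ hα1) n
    rw [add_comm 1 n] at hG
    have hh := recPair_isHomogeneous (α := α) (γ := γ) (b := b) (c := c)
    rw [Nat.fib_add_two]
    refine degSeq_eq_of_eq_mul hG
      (pairTriple_isHomogeneous (hh n).1 (hh n).2 (hh (n + 1)).1 (hh (n + 1)).2)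
      (mul_ne_zero (hr n) (hr (n + 1))) fun H hH h => ?_
    obtain ⟨h1, h2, h3⟩ := recPair_coprime (c := c) hb hγ1 hγ2 hα2 hH n
    by_cases hv : H ∣ (recPair α γ b c (n + 1)).1
    · rcases hH.dvd_or_dvd (h 2) with h4 | h4
      · exact h3 ⟨h4, hv⟩
      · exact h2 ⟨hv, h4⟩
    · have h4 := (hH.dvd_or_dvd (h 0)).resolve_right hv
      have h5 := (hH.dvd_or_dvd (h 1)).resolve_right hv
      rw [dvd_add_right (h4.mul_left _)] at h5
      exact h1 ⟨h4, dvd_of_dvd_C_mul hα2 h5⟩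

end Recurrence

/-! ### Limits of the `n`-th roots. -/

lemma tendsto_two_pow_rpow_inv :
    Tendsto (fun n : ℕ => (((2 ^ n : ℕ) : ℝ)) ^ (1 / (n : ℝ))) atTop (𝓝 2) := by
  refine tendsto_const_nhds.congr' ?_
  filter_upwards [eventually_ne_atTop 0] with n hn
  rw [Nat.cast_pow, one_div, Real.pow_rpow_inv_natCast (by norm_num) hn, Nat.cast_ofNat]

lemma tendsto_succ_rpow_inv :
    Tendsto (fun n : ℕ => (((n + 1 : ℕ) : ℝ)) ^ (1 / (n : ℝ))) atTop (𝓝 1) := by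
  -- This is the limit of `x ^ (1 / (1 * x + -1))` along `x = n + 1`.
  have h := (tendsto_rpow_div_mul_add 1 1 (-1) zero_ne_one).comp
    (tendsto_natCast_atTop_atTop.comp (tendsto_add_atTop_nat 1))
  refine h.congr fun n => ?_
  simp

/-- Powers of the golden ratio satisfy the Fibonacci recurrence, so both bounds propagate from two
initial values. -/
lemma goldenRatio_pow_le_fib (n : ℕ) :
    Real.goldenRatio ^ n ≤ Nat.fib (n + 2) ∧
      (Nat.fib (n + 2) : ℝ) ≤ Real.goldenRatio * Real.goldenRatio ^ n := by
  induction n using Nat.twoStepInduction with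
  | zero => simpa using Real.one_lt_goldenRatio.le
  | one =>
    have := Real.goldenRatio_sq
    have h1 := Real.one_lt_goldenRatio
    have h2 := Real.goldenRatio_lt_two
    norm_num [Nat.fib_add_two]
    constructor <;> nlinarith
  | more n h1 h2 =>
    rw [Nat.fib_add_two, Nat.cast_add]
    have e : Real.goldenRatio ^ (n + 2) = Real.goldenRatio ^ n + Real.goldenRatio ^ (n + 1) := by
      rw [pow_add, Real.goldenRatio_sq]
      ring
    rw [e, mul_add]
    exact ⟨add_le_add h1.1 h2.1, add_le_add h1.2 h2.2⟩

lemma tendsto_fib_rpow_inv :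
    Tendsto (fun n : ℕ => (Nat.fib (n + 2) : ℝ) ^ (1 / (n : ℝ))) atTop (𝓝 Real.goldenRatio) := by
  have hφ := Real.goldenRatio_pos
  have hlim : Tendsto (fun n : ℕ => Real.goldenRatio ^ (1 / (n : ℝ)) * Real.goldenRatio) atTop
      (𝓝 Real.goldenRatio) := by
    have := (Real.continuousAt_const_rpow (b := 0) hφ.ne').tendsto.comp
      (tendsto_one_div_atTop_nhds_zero_nat (𝕜 := ℝ))
    simpa [Function.comp_def] using this.mul_const Real.goldenRatio
  refine tendsto_of_tendsto_of_tendsto_of_le_of_le' tendsto_const_nhds hlim ?_ ?_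
  · filter_upwards [eventually_ne_atTop 0] with n hn
    calc Real.goldenRatio = (Real.goldenRatio ^ n) ^ (1 / (n : ℝ)) := by
          rw [one_div, Real.pow_rpow_inv_natCast hφ.le hn]
      _ ≤ _ := Real.rpow_le_rpow (by positivity) (goldenRatio_pow_le_fib n).1 (by positivity)
  · filter_upwards [eventually_ne_atTop 0] with n hn
    calc _ ≤ (Real.goldenRatio * Real.goldenRatio ^ n) ^ (1 / (n : ℝ)) :=
          Real.rpow_le_rpow (by positivity) (goldenRatio_pow_le_fib n).2 (by positivity)
      _ = _ := by
          rw [Real.mul_rpow hφ.le (by positivity), one_div,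
            Real.pow_rpow_inv_natCast hφ.le hn]

/-! ### Normal form of the map and the three cases. -/

theorem theorem4p1 (α β γ : Fin 3 → ℂ) (hγ : (γ 1, γ 2) ≠ (0, 0))
    (hbir : (familyMap α β γ hγ).IsBirational)
    (hβγ : β 1 * γ 2 - β 2 * γ 1 = 0) (hγγ : γ 1 * γ 2 ≠ 0) :
    (α 1 ≠ 0 → α 2 ≠ 0 →
      HasDynamicalDegree (projExtension α β γ) 2 ∧
        ∀ n : ℕ, degSeq (projExtension α β γ) n = 2 ^ n) ∧
    (α 1 = 0 →
      HasDynamicalDegree (projExtension α β γ) Real.goldenRatio ∧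
        ∀ n : ℕ, degSeq (projExtension α β γ) (n + 2) =
          degSeq (projExtension α β γ) (n + 1) + degSeq (projExtension α β γ) n) ∧
    (α 2 = 0 →
      HasDynamicalDegree (projExtension α β γ) 1 ∧
        ∀ n : ℕ, degSeq (projExtension α β γ) n = n + 1) := by
  have hγ1 : γ 1 ≠ 0 := left_ne_zero_of_mul hγγ
  have hγ2 : γ 2 ≠ 0 := right_ne_zero_of_mul hγγ
  obtain ⟨c, hc⟩ : ∃ c, β 1 = c * γ 1 := ⟨β 1 / γ 1, (div_mul_cancel₀ _ hγ1).symm⟩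
  obtain ⟨b, hb'⟩ : ∃ b, β 0 = c * γ 0 + b := ⟨β 0 - c * γ 0, by ring⟩
  have hc2 : β 2 = c * γ 2 := by
    refine mul_right_cancel₀ hγ1 ?_
    linear_combination γ 2 * hc - hβγ
  have hβ : β = ![c * γ 0 + b, c * γ 1, c * γ 2] := by
    funext i
    fin_cases i
    exacts [hb', hc, hc2]
  have hb : b ≠ 0 := by
    rintro rfl
    refine hbir.not_const 1 c fun z hz => ?_
    have h1 : eval z (affineForm γ) ≠ 0 := by simpa [familyMap] using hz 1
    have h2 : (familyMap α β γ hγ).toFun z 1 = eval z (affineForm β) / eval z (affineForm γ) := rfl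
    rw [h2, div_eq_iff h1]
    simp [affineForm, hb', hc, hc2]
    ring
  have hα : ¬ (α 1 = 0 ∧ α 2 = 0) := by
    rintro ⟨h1, h2⟩
    refine hbir.not_const 0 (α 0) fun z hz => ?_
    simp [familyMap, PlaneRatMap.toFun, affineForm, h1, h2]
  refine ⟨fun h1 h2 => ?_, fun h1 => ?_, fun h2 => ?_⟩
  · have h := degSeq_eq_two_pow hβ hb hγ1 hγ2 h1 h2
    refine ⟨?_, h⟩
    simp only [HasDynamicalDegree, h]
    exact tendsto_two_pow_rpow_inv
  · have h := degSeq_eq_fib hβ hb hγ1 hγ2 h1 fun h2 => hα ⟨h1, h2⟩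
    refine ⟨?_, fun n => ?_⟩
    · simp only [HasDynamicalDegree, h]
      exact tendsto_fib_rpow_inv
    · rw [h, h, h, Nat.fib_add_two (n := n + 2), add_comm]
  · have h := degSeq_eq_succ hβ hb hγ1 hγ2 (fun h1 => hα ⟨h1, h2⟩) h2
    refine ⟨?_, h⟩
    simp only [HasDynamicalDegree, h]
    exact tendsto_succ_rpow_inv
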